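/- Let $n\ge 1$. Alice and Bob share one of $k$ known pairwise orthogonal unit vectors $\Psi_1,\dots,\Psi_k\in\mathbb C^n\otimes\mathbb C^n$, where $\Psi_i$ occurs with a priori probability $p_i$. They apply an LOCC protocol: in each round one of the two parties performs a measurement with finitely many outcomes on the local system, given by Kraus operators $K_j$ with $\sum_j K_j^\dagger K_j=I$ (finite-dimensional ancillas, of any dimension, are allowed), and announces the outcome; all choices may depend on all previous outcomes. The number of rounds need not be bounded, but the protocol terminates with probability one on every input state, with a guess $Z\in\{1,\dots,k\}$. Let $$P(\{\Psi_i\},\{p_i\})=\sup\ \sum_{i=1}^k p_i\,\Pr(Z=i\mid \Psi_i)$$ be the optimal probability of a correct identification, the supremum being over all such protocols, and let $$f(k,n)=\min_{\{\Psi_i\},\{p_i\}}P(\{\Psi_i\},\{p_i\}),$$ where the minimum is over all families of $k$ orthonormal vectors in $\mathbb C^n\otimes\mathbb C^n$ and all probability distributions $(p_1,\dots,p_k)$. For all integers $n\ge2$ and $2\le k\le n^2$ this minimum is attained. For $2\le n\le k\le n^2$, $$\frac2k\ \le\ f(k,n)\ \le\ \frac{\lceil\sqrt k\,\rceil}{k}.$$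 Moreover, for every $n\ge2$, $f(3,n)=\frac23$ and $f(4,n)=\frac12$. -/

import Mathlib

open scoped Kronecker

/-- A quantum measurement on `ℂ^d` with finitely many outcomes, given by Kraus operators `K j`
with `∑ j, (K j)† (K j) = 1`. The space after the measurement may have any finite dimension
(it may depend on the outcome), so attaching a finite dimensional ancilla, applying a unitary,
and measuring are all of this form. -/
structure LocalMeasurement (d : ℕ) where
  numOutcomes : ℕ
  outDim : Fin numOutcomes → ℕ
  K : ∀ j : Fin numOutcomes, Matrix (Fin (outDim j)) (Fin d) ℂ
  complete : ∑ j, (K j).conjTranspose * K j = 1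

/-- What the two parties do next, when Alice holds `ℂ^a` and Bob holds `ℂ^b`: they stop and
announce a guess in `Fin k`, or one of them measures the local system and broadcasts the outcome.
The outcome `j` leads to the classical state `next j`, in `S a' b'` where `a'` and `b'` are
the new local dimensions. -/
inductive LOCCMove (k : ℕ) (S : ℕ → ℕ → Type) (a b : ℕ) : Type
  | halt (guess : Fin k)
  | alice (M : LocalMeasurement a) (next : ∀ j, S (M.outDim j) b)
  | bob (M : LocalMeasurement b) (next : ∀ j, S a (M.outDim j))

/-- A two-party LOCC protocol on `ℂ^a ⊗ ℂ^b` that outputs a guess in `Fin k`. A classical state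
in `State a' b'` is known to both parties and may record the whole history of outcomes; the
number of rounds need not be bounded. -/
structure LOCCProtocol (k a b : ℕ) where
  State : ℕ → ℕ → Type
  move : ∀ {a' b' : ℕ}, State a' b' → LOCCMove k State a' b'
  start : State a b

/-- The operator `A ⊗ 1` applied to a vector of `ℂ^a ⊗ ℂ^b = ℂ^(a × b)`. -/
noncomputable def applyAlice {a a' b : ℕ} (A : Matrix (Fin a') (Fin a) ℂ)
    (ψ : EuclideanSpace ℂ (Fin a × Fin b)) : EuclideanSpace ℂ (Fin a' × Fin b) :=
  WithLp.toLp 2 (Matrix.mulVec (A ⊗ₖ (1 : Matrix (Fin b) (Fin b) ℂ)) ψ.ofLp)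

/-- The operator `1 ⊗ B` applied to a vector of `ℂ^a ⊗ ℂ^b = ℂ^(a × b)`. -/
noncomputable def applyBob {a b b' : ℕ} (B : Matrix (Fin b') (Fin b) ℂ)
    (ψ : EuclideanSpace ℂ (Fin a × Fin b)) : EuclideanSpace ℂ (Fin a × Fin b') :=
  WithLp.toLp 2 (Matrix.mulVec ((1 : Matrix (Fin a) (Fin a) ℂ) ⊗ₖ B) ψ.ofLp)

namespace LOCCProtocol

variable {k a b : ℕ}

/-- The weight of the event that, started in the classical state `s` with the (unnormalized)
quantum state `ψ`, the protocol stops after at most `r` measurements with the guess `i`. An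
unnormalized state carries its squared norm as the probability of having been reached. -/
noncomputable def guessProbWithin (Q : LOCCProtocol k a b) (i : Fin k) :
    (r : ℕ) → {a' b' : ℕ} → Q.State a' b' → EuclideanSpace ℂ (Fin a' × Fin b') → ℝ
  | 0, _, _, s, ψ =>
    match Q.move s with
    | .halt g => if g = i then ‖ψ‖ ^ 2 else 0
    | .alice _ _ => 0
    | .bob _ _ => 0
  | r + 1, _, _, s, ψ =>
    match Q.move s with
    | .halt g => if g = i then ‖ψ‖ ^ 2 else 0
    | .alice M next => ∑ j, guessProbWithin Q i r (next j) (applyAlice (M.K j) ψ)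
    | .bob M next => ∑ j, guessProbWithin Q i r (next j) (applyBob (M.K j) ψ)

/-- The probability that the protocol, run on the state `ψ`, ever stops with the guess `i`:
the increasing limit of the probabilities of doing so within `r` measurements. -/
noncomputable def guessProb (Q : LOCCProtocol k a b) (i : Fin k)
    (ψ : EuclideanSpace ℂ (Fin a × Fin b)) : ℝ :=
  ⨆ r : ℕ, Q.guessProbWithin i r Q.start ψ

/-- The protocol terminates with probability one on every input state. -/
def Terminates (Q : LOCCProtocol k a b) : Prop :=
  ∀ ψ : EuclideanSpace ℂ (Fin a × Fin b), ‖ψ‖ = 1 → ∑ i, Q.guessProb i ψ = 1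

end LOCCProtocol

/-- The optimal probability of correctly identifying which of the states `Ψ i`, having
a priori probabilities `p i`, is shared: the supremum of `P(Z = V)` over all LOCC protocols that
terminate with probability one. -/
noncomputable def loccSuccess {k n : ℕ} (Ψ : Fin k → EuclideanSpace ℂ (Fin n × Fin n))
    (p : Fin k → ℝ) : ℝ :=
  ⨆ Q : {Q : LOCCProtocol k n n // Q.Terminates}, ∑ i, p i * Q.1.guessProb i (Ψ i)

/-- The optimal success probabilities of all ensembles of `k` orthogonal states of `ℂ^n ⊗ ℂ^n`
with arbitrary a priori probabilities. -/
def loccSuccessValues (k n : ℕ) : Set ℝ :=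
  {x | ∃ (Ψ : Fin k → EuclideanSpace ℂ (Fin n × Fin n)) (p : Fin k → ℝ),
    Orthonormal ℂ Ψ ∧ p ∈ stdSimplex ℝ (Fin k) ∧ x = loccSuccess Ψ p}

/-- The worst-case LOCC success probability `f(k,n)`. -/
noncomputable def loccWorstCase (k n : ℕ) : ℝ :=
  sInf (loccSuccessValues k n)

/-! ### Local operators and conservation of outcome probabilities. -/

section Measurement

/-! Attainment. For a fixed protocol the success probability is a supremum of truncations continuous
in `(Ψ, p)`, hence lower semicontinuous where `p ≥ 0`; so is the supremum over protocols.
Orthonormal families and probability vectors form a compact set, where such a function attains its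
minimum (`isLeast_loccWorstCase`).

Upper bound. Let `m = ⌈√k⌉` and take `k` of the `m²` Bell states of `ℂ^m ⊗ ℂ^m` with uniform priors.
Every branch of a protocol acts by a product operator `A ⊗ B`, so by Cauchy–Schwarz a guess has on a
Bell state at most `1/m` times its total weight on the `m²` product basis vectors. Summing over the
guesses gives at most `m² / m = m`, hence success at most `m / k`
(`LOCCProtocol.guessProbWithin_sum_prodVec_le`, `LOCCProtocol.sum_guessProb_bellState_le`).

Lower bound. Some two states have total prior at least `2 / k`, and two orthogonal states are
distinguished perfectly: a traceless matrix has zero diagonal with respect to some rank one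
measurement of Alice, which leaves Bob with orthogonal conditional states
(`exists_outerSum_eq_one_of_trace_eq_zero`, `exists_tree_of_inner_eq_zero`). For `k = 3, 4` one has
`⌈√k⌉ = 2` and the bounds meet. -/

theorem applyAlice_apply {a a' b : ℕ} (A : Matrix (Fin a') (Fin a) ℂ)
    (ψ : EuclideanSpace ℂ (Fin a × Fin b)) (x : Fin a') (y : Fin b) :
    applyAlice A ψ (x, y) = ∑ z, A x z * ψ (z, y) := by
  simp [applyAlice, Matrix.mulVec, dotProduct, Fintype.sum_prod_type, Matrix.one_apply]

theorem applyBob_apply {a b b' : ℕ} (B : Matrix (Fin b') (Fin b) ℂ)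
    (ψ : EuclideanSpace ℂ (Fin a × Fin b)) (x : Fin a) (y : Fin b') :
    applyBob B ψ (x, y) = ∑ z, B y z * ψ (x, z) := by
  simp [applyBob, Matrix.mulVec, dotProduct, Fintype.sum_prod_type, Matrix.one_apply]

theorem continuous_applyAlice {a a' b : ℕ} (A : Matrix (Fin a') (Fin a) ℂ) :
    Continuous (applyAlice (b := b) A) := by
  unfold applyAlice
  exact (PiLp.continuous_toLp 2 _).comp
    ((Continuous.matrix_mulVec continuous_const continuous_id).comp (PiLp.continuous_ofLp 2 _))

theorem continuous_applyBob {a b b' : ℕ} (B : Matrix (Fin b') (Fin b) ℂ) :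
    Continuous (applyBob (a := a) B) := by
  unfold applyBob
  exact (PiLp.continuous_toLp 2 _).comp
    ((Continuous.matrix_mulVec continuous_const continuous_id).comp (PiLp.continuous_ofLp 2 _))

theorem ofReal_sum_norm_sq_eq_dotProduct {ι : Type*} [Fintype ι] (v : ι → ℂ) :
    ((∑ i, ‖v i‖ ^ 2 : ℝ) : ℂ) = star v ⬝ᵥ v := by
  simp [dotProduct, Complex.conj_mul']

/-- The outcome probabilities of a measurement add up to the squared norm. -/
theorem LocalMeasurement.sum_norm_sq_mulVec {d : ℕ} (M : LocalMeasurement d) (v : Fin d → ℂ) :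
    ∑ j, ∑ x, ‖(M.K j).mulVec v x‖ ^ 2 = ∑ x, ‖v x‖ ^ 2 := by
  have h : (((∑ j, ∑ x, ‖(M.K j).mulVec v x‖ ^ 2 : ℝ)) : ℂ) = ((∑ x, ‖v x‖ ^ 2 : ℝ) : ℂ) := by
    rw [Complex.ofReal_sum]
    simp_rw [ofReal_sum_norm_sq_eq_dotProduct, Matrix.star_mulVec, Matrix.dotProduct_mulVec,
      Matrix.vecMul_vecMul, ← Matrix.dotProduct_mulVec]
    rw [← dotProduct_sum, ← Matrix.sum_mulVec, M.complete, Matrix.one_mulVec]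
  exact_mod_cast h

theorem LocalMeasurement.sum_norm_sq_applyAlice {a b : ℕ} (M : LocalMeasurement a)
    (ψ : EuclideanSpace ℂ (Fin a × Fin b)) :
    ∑ j, ‖applyAlice (M.K j) ψ‖ ^ 2 = ‖ψ‖ ^ 2 := by
  simp_rw [EuclideanSpace.norm_sq_eq, Fintype.sum_prod_type_right, applyAlice_apply]
  rw [Finset.sum_comm]
  exact Finset.sum_congr rfl fun y _ => M.sum_norm_sq_mulVec fun z => ψ (z, y)

theorem LocalMeasurement.sum_norm_sq_applyBob {a b : ℕ} (M : LocalMeasurement b)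
    (ψ : EuclideanSpace ℂ (Fin a × Fin b)) :
    ∑ j, ‖applyBob (M.K j) ψ‖ ^ 2 = ‖ψ‖ ^ 2 := by
  simp_rw [EuclideanSpace.norm_sq_eq, Fintype.sum_prod_type, applyBob_apply]
  rw [Finset.sum_comm]
  exact Finset.sum_congr rfl fun x _ => M.sum_norm_sq_mulVec fun z => ψ (x, z)

end Measurement

/-! ### Truncated guess probabilities: bounds and continuity in the state. -/

namespace LOCCProtocol

variable {k a b : ℕ} (Q : LOCCProtocol k a b) (i : Fin k)

theorem guessProbWithin_of_halt {a' b' : ℕ} {s : Q.State a' b'} {g : Fin k}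
    (h : Q.move s = .halt g) (r : ℕ) (ψ : EuclideanSpace ℂ (Fin a' × Fin b')) :
    Q.guessProbWithin i r s ψ = if g = i then ‖ψ‖ ^ 2 else 0 := by
  cases r <;> simp only [guessProbWithin, h]

theorem guessProbWithin_zero_of_alice {a' b' : ℕ} {s : Q.State a' b'} {M : LocalMeasurement a'}
    {next : ∀ j, Q.State (M.outDim j) b'} (h : Q.move s = .alice M next)
    (ψ : EuclideanSpace ℂ (Fin a' × Fin b')) : Q.guessProbWithin i 0 s ψ = 0 := by
  simp only [guessProbWithin, h]

theorem guessProbWithin_zero_of_bob {a' b' : ℕ} {s : Q.State a' b'} {M : LocalMeasurement b'}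
    {next : ∀ j, Q.State a' (M.outDim j)} (h : Q.move s = .bob M next)
    (ψ : EuclideanSpace ℂ (Fin a' × Fin b')) : Q.guessProbWithin i 0 s ψ = 0 := by
  simp only [guessProbWithin, h]

theorem guessProbWithin_succ_of_alice {a' b' : ℕ} {s : Q.State a' b'} {M : LocalMeasurement a'}
    {next : ∀ j, Q.State (M.outDim j) b'} (h : Q.move s = .alice M next) (r : ℕ)
    (ψ : EuclideanSpace ℂ (Fin a' × Fin b')) :
    Q.guessProbWithin i (r + 1) s ψ =
      ∑ j, Q.guessProbWithin i r (next j) (applyAlice (M.K j) ψ) := by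
  simp only [guessProbWithin, h]

theorem guessProbWithin_succ_of_bob {a' b' : ℕ} {s : Q.State a' b'} {M : LocalMeasurement b'}
    {next : ∀ j, Q.State a' (M.outDim j)} (h : Q.move s = .bob M next) (r : ℕ)
    (ψ : EuclideanSpace ℂ (Fin a' × Fin b')) :
    Q.guessProbWithin i (r + 1) s ψ =
      ∑ j, Q.guessProbWithin i r (next j) (applyBob (M.K j) ψ) := by
  simp only [guessProbWithin, h]

theorem guessProbWithin_le_norm_sq (r : ℕ) {a' b' : ℕ} (s : Q.State a' b')
    (ψ : EuclideanSpace ℂ (Fin a' × Fin b')) : Q.guessProbWithin i r s ψ ≤ ‖ψ‖ ^ 2 := by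
  induction r generalizing a' b' with
  | zero =>
    cases h : Q.move s with
    | halt g => rw [Q.guessProbWithin_of_halt i h]; split_ifs <;> simp
    | alice M next => rw [Q.guessProbWithin_zero_of_alice i h]; positivity
    | bob M next => rw [Q.guessProbWithin_zero_of_bob i h]; positivity
  | succ r ih =>
    cases h : Q.move s with
    | halt g => rw [Q.guessProbWithin_of_halt i h]; split_ifs <;> simp
    | alice M next =>
      rw [Q.guessProbWithin_succ_of_alice i h, ← M.sum_norm_sq_applyAlice ψ]
      exact Finset.sum_le_sum fun j _ => ih _ _
    | bob M next =>
      rw [Q.guessProbWithin_succ_of_bob i h, ← M.sum_norm_sq_applyBob ψ]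
      exact Finset.sum_le_sum fun j _ => ih _ _

theorem continuous_guessProbWithin (r : ℕ) {a' b' : ℕ} (s : Q.State a' b') :
    Continuous (Q.guessProbWithin i r s) := by
  induction r generalizing a' b' with
  | zero =>
    cases h : Q.move s with
    | halt g =>
      rw [funext (Q.guessProbWithin_of_halt i h 0)]
      split_ifs <;> fun_prop
    | alice M next => rw [funext (Q.guessProbWithin_zero_of_alice i h)]; fun_prop
    | bob M next => rw [funext (Q.guessProbWithin_zero_of_bob i h)]; fun_prop
  | succ r ih =>
    cases h : Q.move s with
    | halt g =>
      rw [funext (Q.guessProbWithin_of_halt i h (r + 1))]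
      split_ifs <;> fun_prop
    | alice M next =>
      rw [funext (Q.guessProbWithin_succ_of_alice i h r)]
      exact continuous_finsetSum _ fun j _ => (ih _).comp (continuous_applyAlice _)
    | bob M next =>
      rw [funext (Q.guessProbWithin_succ_of_bob i h r)]
      exact continuous_finsetSum _ fun j _ => (ih _).comp (continuous_applyBob _)

theorem bddAbove_guessProbWithin (ψ : EuclideanSpace ℂ (Fin a × Fin b)) :
    BddAbove (Set.range fun r => Q.guessProbWithin i r Q.start ψ) :=
  ⟨‖ψ‖ ^ 2, by rintro _ ⟨r, rfl⟩; exact Q.guessProbWithin_le_norm_sq i r _ _⟩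

theorem guessProb_le_norm_sq (ψ : EuclideanSpace ℂ (Fin a × Fin b)) :
    Q.guessProb i ψ ≤ ‖ψ‖ ^ 2 :=
  ciSup_le fun r => Q.guessProbWithin_le_norm_sq i r _ _

/-- A supremum of continuous truncations is lower semicontinuous; `0 ≤ p x` allows the factor to be
moved inside the supremum. -/
theorem lowerSemicontinuousOn_mul_guessProb {X : Type*} [TopologicalSpace X] {S : Set X}
    {p : X → ℝ} {Ψ : X → EuclideanSpace ℂ (Fin a × Fin b)} (hp : Continuous p)
    (hΨ : Continuous Ψ) (h0 : ∀ x ∈ S, 0 ≤ p x) :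
    LowerSemicontinuousOn (fun x => p x * Q.guessProb i (Ψ x)) S := by
  have h : LowerSemicontinuousOn
      (fun x => ⨆ r : ℕ, p x * Q.guessProbWithin i r Q.start (Ψ x)) S := by
    refine lowerSemicontinuousOn_ciSup (fun x hx => ?_) fun r =>
      (hp.mul ((Q.continuous_guessProbWithin i r _).comp hΨ)).lowerSemicontinuous
        |>.lowerSemicontinuousOn S
    refine ⟨p x * ‖Ψ x‖ ^ 2, ?_⟩
    rintro _ ⟨r, rfl⟩
    exact mul_le_mul_of_nonneg_left (Q.guessProbWithin_le_norm_sq i r _ _) (h0 x hx)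
  have heq : ∀ x ∈ S, p x * Q.guessProb i (Ψ x) =
      ⨆ r : ℕ, p x * Q.guessProbWithin i r Q.start (Ψ x) :=
    fun x hx => Real.mul_iSup_of_nonneg (h0 x hx) _
  intro x hx y hy
  filter_upwards [h x hx y (lt_of_lt_of_eq hy (heq x hx)), self_mem_nhdsWithin] with z hz hzS
  exact lt_of_lt_of_eq hz (heq z hzS).symm

end LOCCProtocol

/-! ### Attainment of the minimum by compactness. -/

section Attained

theorem sum_mul_guessProb_le_one {k n : ℕ} {Ψ : Fin k → EuclideanSpace ℂ (Fin n × Fin n)}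
    {p : Fin k → ℝ} (hΨ : ∀ i, ‖Ψ i‖ = 1) (hp : p ∈ stdSimplex ℝ (Fin k))
    (Q : LOCCProtocol k n n) : ∑ i, p i * Q.guessProb i (Ψ i) ≤ 1 := by
  rw [← hp.2]
  refine Finset.sum_le_sum fun i _ => mul_le_of_le_one_right (hp.1 i) ?_
  simpa [hΨ i] using Q.guessProb_le_norm_sq i (Ψ i)

/-- Without this bound the real supremum in `loccSuccess` could take its default value `0`. -/
theorem bddAbove_range_sum_mul_guessProb {k n : ℕ}
    {Ψ : Fin k → EuclideanSpace ℂ (Fin n × Fin n)}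
    {p : Fin k → ℝ} (hΨ : ∀ i, ‖Ψ i‖ = 1) (hp : p ∈ stdSimplex ℝ (Fin k)) :
    BddAbove (Set.range fun Q : {Q : LOCCProtocol k n n // Q.Terminates} =>
      ∑ i, p i * Q.1.guessProb i (Ψ i)) :=
  ⟨1, by rintro _ ⟨Q, rfl⟩; exact sum_mul_guessProb_le_one hΨ hp Q.1⟩

theorem isClosed_setOf_orthonormal (ι E : Type*) [Fintype ι] [NormedAddCommGroup E]
    [InnerProductSpace ℂ E] : IsClosed {v : ι → E | Orthonormal ℂ v} := by
  classical
  simp_rw [orthonormal_iff_ite, Set.ofPred_forall]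
  refine isClosed_iInter fun i => isClosed_iInter fun j => isClosed_eq ?_ continuous_const
  fun_prop

theorem isCompact_setOf_orthonormal (ι E : Type*) [Fintype ι] [NormedAddCommGroup E]
    [InnerProductSpace ℂ E] [FiniteDimensional ℂ E] :
    IsCompact {v : ι → E | Orthonormal ℂ v} := by
  have := FiniteDimensional.proper ℂ E
  refine IsCompact.of_isClosed_subset (isCompact_closedBall (0 : ι → E) 1)
    (isClosed_setOf_orthonormal ι E) fun v hv => ?_
  rw [mem_closedBall_zero_iff, pi_norm_le_iff_of_nonneg zero_le_one]
  exact fun i => (hv.1 i).le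

theorem isLeast_loccWorstCase {k n : ℕ} (hk : 0 < k) (hkn : k ≤ n ^ 2) :
    IsLeast (loccSuccessValues k n) (loccWorstCase k n) := by
  set S : Set ((Fin k → EuclideanSpace ℂ (Fin n × Fin n)) × (Fin k → ℝ)) :=
    {v | Orthonormal ℂ v} ×ˢ stdSimplex ℝ (Fin k) with hS
  have hcompact : IsCompact S :=
    (isCompact_setOf_orthonormal _ _).prod (isCompact_stdSimplex ℝ _)
  have hne : S.Nonempty := by
    -- Here `k ≤ n ^ 2` enters: `k` vectors of the standard basis form an admissible family.
    obtain ⟨e⟩ : Nonempty (Fin k ↪ Fin n × Fin n) :=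
      Function.Embedding.nonempty_of_card_le (by simpa [← sq] using hkn)
    exact ⟨(_, _), (EuclideanSpace.basisFun (Fin n × Fin n) ℂ).orthonormal.comp e e.injective,
      single_mem_stdSimplex ℝ (⟨0, hk⟩ : Fin k)⟩
  have hlsc : LowerSemicontinuousOn (fun x => loccSuccess x.1 x.2) S := by
    refine lowerSemicontinuousOn_ciSup
      (fun x hx => bddAbove_range_sum_mul_guessProb hx.1.1 hx.2) fun Q => ?_
    refine lowerSemicontinuousOn_sum fun i _ =>
      Q.1.lowerSemicontinuousOn_mul_guessProb i (by fun_prop) (by fun_prop) fun x hx => hx.2.1 i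
  obtain ⟨x, hx, hmin⟩ := hlsc.exists_isMinOn hne hcompact
  have hleast : IsLeast (loccSuccessValues k n) (loccSuccess x.1 x.2) := by
    refine ⟨⟨x.1, x.2, hx.1, hx.2, rfl⟩, ?_⟩
    rintro _ ⟨Ψ, p, hΨ, hp, rfl⟩
    exact hmin (show (Ψ, p) ∈ S from ⟨hΨ, hp⟩)
  rw [loccWorstCase, hleast.csInf_eq]
  exact hleast

end Attained

/-! ### Product vectors and the bound for superpositions of them. -/

section ProductVectors

/-- The product vector `x ⊗ y`. -/
noncomputable def prodVec {a b : ℕ} (x : EuclideanSpace ℂ (Fin a)) (y : EuclideanSpace ℂ (Fin b)) :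
    EuclideanSpace ℂ (Fin a × Fin b) :=
  WithLp.toLp 2 fun q => x q.1 * y q.2

theorem prodVec_apply {a b : ℕ} (x : EuclideanSpace ℂ (Fin a)) (y : EuclideanSpace ℂ (Fin b))
    (q : Fin a × Fin b) : prodVec x y q = x q.1 * y q.2 := rfl

theorem inner_prodVec {a b : ℕ} (x x' : EuclideanSpace ℂ (Fin a))
    (y y' : EuclideanSpace ℂ (Fin b)) :
    inner ℂ (prodVec x y) (prodVec x' y') = inner ℂ x x' * inner ℂ y y' := by
  simp only [PiLp.inner_apply, prodVec_apply, RCLike.inner_apply, map_mul, Fintype.sum_prod_type,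
    Finset.sum_mul_sum]
  exact Finset.sum_congr rfl fun i _ => Finset.sum_congr rfl fun j _ => by ring

theorem norm_prodVec {a b : ℕ} (x : EuclideanSpace ℂ (Fin a)) (y : EuclideanSpace ℂ (Fin b)) :
    ‖prodVec x y‖ = ‖x‖ * ‖y‖ := by
  have h : ‖prodVec x y‖ ^ 2 = (‖x‖ * ‖y‖) ^ 2 := by
    have h' := inner_prodVec x x y y
    simp only [inner_self_eq_norm_sq_to_K] at h'
    rw [mul_pow]
    exact_mod_cast h'
  exact (sq_eq_sq₀ (norm_nonneg _) (by positivity)).1 h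

theorem applyAlice_sum_prodVec {ι : Type*} [Fintype ι] {a a' b : ℕ}
    (A : Matrix (Fin a') (Fin a) ℂ) (c : ι → ℂ) (x : ι → EuclideanSpace ℂ (Fin a))
    (y : ι → EuclideanSpace ℂ (Fin b)) :
    applyAlice A (∑ j, c j • prodVec (x j) (y j)) =
      ∑ j, c j • prodVec (WithLp.toLp 2 (A.mulVec (x j))) (y j) := by
  ext ⟨p, q⟩
  simp only [applyAlice_apply, WithLp.ofLp_sum, Finset.sum_apply, PiLp.smul_apply, prodVec_apply,
    Matrix.mulVec, dotProduct, Finset.mul_sum, Finset.sum_mul, smul_eq_mul]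
  rw [Finset.sum_comm]
  exact Finset.sum_congr rfl fun i _ => Finset.sum_congr rfl fun j _ => by ring

theorem applyBob_sum_prodVec {ι : Type*} [Fintype ι] {a b b' : ℕ}
    (B : Matrix (Fin b') (Fin b) ℂ) (c : ι → ℂ) (x : ι → EuclideanSpace ℂ (Fin a))
    (y : ι → EuclideanSpace ℂ (Fin b)) :
    applyBob B (∑ j, c j • prodVec (x j) (y j)) =
      ∑ j, c j • prodVec (x j) (WithLp.toLp 2 (B.mulVec (y j))) := by
  ext ⟨p, q⟩
  simp only [applyBob_apply, WithLp.ofLp_sum, Finset.sum_apply, PiLp.smul_apply, prodVec_apply,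
    Matrix.mulVec, dotProduct, Finset.mul_sum, smul_eq_mul]
  rw [Finset.sum_comm]
  exact Finset.sum_congr rfl fun i _ => Finset.sum_congr rfl fun j _ => by ring

theorem applyAlice_prodVec {a a' b : ℕ} (A : Matrix (Fin a') (Fin a) ℂ)
    (x : EuclideanSpace ℂ (Fin a)) (y : EuclideanSpace ℂ (Fin b)) :
    applyAlice A (prodVec x y) = prodVec (WithLp.toLp 2 (A.mulVec x)) y := by
  simpa using applyAlice_sum_prodVec A (fun _ : Unit => 1) (fun _ => x) fun _ => y

theorem applyBob_prodVec {a b b' : ℕ} (B : Matrix (Fin b') (Fin b) ℂ)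
    (x : EuclideanSpace ℂ (Fin a)) (y : EuclideanSpace ℂ (Fin b)) :
    applyBob B (prodVec x y) = prodVec x (WithLp.toLp 2 (B.mulVec y)) := by
  simpa using applyBob_sum_prodVec B (fun _ : Unit => 1) (fun _ => x) fun _ => y

/-- Triangle inequality, then Cauchy–Schwarz for `∑ ‖x j‖ ‖y (σ j)‖`. Since `σ` is a permutation,
the two resulting sums multiply out to the sum over all pairs `(j, l)`. -/
theorem norm_sq_sum_prodVec_le {ι : Type*} [Fintype ι] {a b : ℕ} {c : ι → ℂ} {C : ℝ}
    (hc : ∀ j, ‖c j‖ ≤ C) (σ : Equiv.Perm ι) (x : ι → EuclideanSpace ℂ (Fin a))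
    (y : ι → EuclideanSpace ℂ (Fin b)) :
    ‖∑ j, c j • prodVec (x j) (y (σ j))‖ ^ 2 ≤
      C ^ 2 * ∑ j, ∑ l, ‖prodVec (x j) (y l)‖ ^ 2 := by
  have h1 : ‖∑ j, c j • prodVec (x j) (y (σ j))‖ ≤ C * ∑ j, ‖x j‖ * ‖y (σ j)‖ := by
    rw [Finset.mul_sum]
    refine (norm_sum_le _ _).trans (Finset.sum_le_sum fun j _ => ?_)
    rw [norm_smul, norm_prodVec]
    exact mul_le_mul_of_nonneg_right (hc j) (by positivity)
  have h2 : (∑ j, ‖x j‖ * ‖y (σ j)‖) ^ 2 ≤ (∑ j, ‖x j‖ ^ 2) * ∑ l, ‖y l‖ ^ 2 := by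
    rw [← Equiv.sum_comp σ fun l => ‖y l‖ ^ 2]
    exact Finset.sum_mul_sq_le_sq_mul_sq _ _ _
  simp_rw [norm_prodVec, mul_pow, ← Finset.mul_sum, ← Finset.sum_mul]
  calc _ ≤ (C * ∑ j, ‖x j‖ * ‖y (σ j)‖) ^ 2 := by gcongr
    _ = C ^ 2 * (∑ j, ‖x j‖ * ‖y (σ j)‖) ^ 2 := by ring
    _ ≤ _ := by gcongr

/-- A separable measurement answers on a superposition of the `m` product vectors
`x j ⊗ y (σ j)` with at most the total weight with which it answers on all the product vectors
`x j ⊗ y l`, times a bound for the squared coefficients. -/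
theorem LOCCProtocol.guessProbWithin_sum_prodVec_le {k a b : ℕ} (Q : LOCCProtocol k a b)
    (i : Fin k) {ι : Type*} [Fintype ι] {c : ι → ℂ} {C : ℝ} (hc : ∀ j, ‖c j‖ ≤ C)
    (σ : Equiv.Perm ι) (r : ℕ) {a' b' : ℕ} (s : Q.State a' b')
    (x : ι → EuclideanSpace ℂ (Fin a')) (y : ι → EuclideanSpace ℂ (Fin b')) :
    Q.guessProbWithin i r s (∑ j, c j • prodVec (x j) (y (σ j))) ≤
      C ^ 2 * ∑ j, ∑ l, Q.guessProbWithin i r s (prodVec (x j) (y l)) := by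
  have halt_case : ∀ (r : ℕ) {a' b' : ℕ} {s : Q.State a' b'} {g : Fin k}
      (x : ι → EuclideanSpace ℂ (Fin a')) (y : ι → EuclideanSpace ℂ (Fin b')),
      Q.move s = .halt g → Q.guessProbWithin i r s (∑ j, c j • prodVec (x j) (y (σ j))) ≤
        C ^ 2 * ∑ j, ∑ l, Q.guessProbWithin i r s (prodVec (x j) (y l)) := by
    intro r a' b' s g x y h
    simp_rw [Q.guessProbWithin_of_halt i h]
    split_ifs
    · exact norm_sq_sum_prodVec_le hc σ x y
    · simp
  -- A local Kraus operator sends each product vector to a product vector and leaves `c` and `σ`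
  -- unchanged, so the claim for arbitrary unnormalized `x`, `y` passes through every round.
  induction r generalizing a' b' with
  | zero =>
    cases h : Q.move s with
    | halt g => exact halt_case _ x y h
    | alice M next => simp [Q.guessProbWithin_zero_of_alice i h]
    | bob M next => simp [Q.guessProbWithin_zero_of_bob i h]
  | succ r ih =>
    cases h : Q.move s with
    | halt g => exact halt_case _ x y h
    | alice M next =>
      simp_rw [Q.guessProbWithin_succ_of_alice i h, applyAlice_prodVec]
      rw [Finset.sum_congr rfl fun j _ => Finset.sum_comm, Finset.sum_comm, Finset.mul_sum]
      refine Finset.sum_le_sum fun j _ => ?_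
      rw [applyAlice_sum_prodVec (M.K j) c x fun l => y (σ l)]
      exact ih (next j) (fun l => WithLp.toLp 2 ((M.K j).mulVec (x l))) y
    | bob M next =>
      simp_rw [Q.guessProbWithin_succ_of_bob i h, applyBob_prodVec]
      rw [Finset.sum_congr rfl fun j _ => Finset.sum_comm, Finset.sum_comm, Finset.mul_sum]
      refine Finset.sum_le_sum fun j _ => ?_
      rw [applyBob_sum_prodVec (M.K j) c x fun l => y (σ l)]
      exact ih (next j) x (fun l => WithLp.toLp 2 ((M.K j).mulVec (y l)))

theorem LOCCProtocol.guessProb_sum_prodVec_le {k a b : ℕ} (Q : LOCCProtocol k a b)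
    (i : Fin k) {ι : Type*} [Fintype ι] {c : ι → ℂ} {C : ℝ} (hc : ∀ j, ‖c j‖ ≤ C)
    (σ : Equiv.Perm ι) (x : ι → EuclideanSpace ℂ (Fin a)) (y : ι → EuclideanSpace ℂ (Fin b)) :
    Q.guessProb i (∑ j, c j • prodVec (x j) (y (σ j))) ≤
      C ^ 2 * ∑ j, ∑ l, Q.guessProb i (prodVec (x j) (y l)) := by
  refine ciSup_le fun r => (Q.guessProbWithin_sum_prodVec_le i hc σ r _ x y).trans ?_
  gcongr with j _ l _
  exact le_ciSup (Q.bddAbove_guessProbWithin i _) r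

end ProductVectors

/-! ### Generalized Bell states and the upper bound. -/

section BellStates

variable {m n : ℕ} [NeZero m]

/-- The generalized Bell states of `ℂ^m ⊗ ℂ^m`, embedded in `ℂ^n ⊗ ℂ^n`. -/
noncomputable def bellState (e : ZMod m ↪ Fin n) (q : ZMod m × ZMod m) :
    EuclideanSpace ℂ (Fin n × Fin n) :=
  ∑ j : ZMod m, (ZMod.stdAddChar (j * q.1) * ((√m : ℝ) : ℂ)⁻¹ : ℂ) •
    prodVec (EuclideanSpace.single (e j) 1)
      (EuclideanSpace.single (e (Equiv.addRight q.2 j)) 1)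

/-- Different shifts give disjoint supports in the product basis; for equal shifts the inner product
is a normalized sum of an additive character. -/
theorem orthonormal_bellState (e : ZMod m ↪ Fin n) : Orthonormal ℂ (bellState e) := by
  rw [orthonormal_iff_ite]
  rintro ⟨a, b⟩ ⟨a', b'⟩
  have hm : ((√m : ℝ) : ℂ) * ((√m : ℝ) : ℂ) = m := by
    rw [← Complex.ofReal_mul, Real.mul_self_sqrt (Nat.cast_nonneg m), Complex.ofReal_natCast]
  have hm0 : (m : ℂ) ≠ 0 := Nat.cast_ne_zero.2 (NeZero.ne m)
  have hprod : ∀ j l : ZMod m,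
      inner ℂ (prodVec (EuclideanSpace.single (e j) 1)
          (EuclideanSpace.single (e (Equiv.addRight b j)) 1) : EuclideanSpace ℂ (Fin n × Fin n))
        (prodVec (EuclideanSpace.single (e l) 1)
          (EuclideanSpace.single (e (Equiv.addRight b' l)) 1)) =
      if j = l then if b = b' then 1 else 0 else 0 := by
    intro j l
    rw [inner_prodVec]
    by_cases hjl : j = l
    · subst hjl
      simp [EuclideanSpace.inner_single_left, PiLp.single_apply, e.injective.eq_iff]
    · simp [EuclideanSpace.inner_single_left, PiLp.single_apply, e.injective.eq_iff, hjl]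
  have key : inner ℂ (bellState e (a, b)) (bellState e (a', b')) =
      if b = b' then (∑ j : ZMod m, (ZMod.stdAddChar (j * (a' - a)) : ℂ)) * (m : ℂ)⁻¹ else 0 := by
    simp only [bellState, sum_inner, inner_sum, inner_smul_left, inner_smul_right, hprod,
      mul_ite, mul_one, mul_zero, Finset.sum_ite_eq', Finset.mem_univ, if_true]
    split_ifs with h
    · rw [Finset.sum_mul]
      refine Finset.sum_congr rfl fun j _ => ?_
      rw [mul_sub, sub_eq_add_neg, AddChar.map_add_eq_mul, AddChar.map_neg_eq_conj,
        (starRingEnd ℂ).map_mul, map_inv₀ (starRingEnd ℂ), Complex.conj_ofReal, ← hm, mul_inv]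
      ring
    · simp
  rw [key, AddChar.sum_mulShift _ (ZMod.isPrimitive_stdAddChar m)]
  by_cases hb : b = b' <;> by_cases ha : a = a'
  · simp [hb, ha, ZMod.card, hm0]
  · simp [hb, ha, sub_eq_zero, Ne.symm ha]
  · simp [hb]
  · simp [hb]

/-- The coefficients have modulus `1 / √m`, which yields the factor `1 / m` in front of a sum over
`m²` product basis vectors. -/
theorem LOCCProtocol.sum_guessProb_bellState_le {k : ℕ} {Q : LOCCProtocol k n n}
    (hQ : Q.Terminates) (e : ZMod m ↪ Fin n) (q : Fin k → ZMod m × ZMod m) :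
    ∑ i, Q.guessProb i (bellState e (q i)) ≤ m := by
  have hm0 : (m : ℝ) ≠ 0 := Nat.cast_ne_zero.2 (NeZero.ne m)
  have h : ∀ i, Q.guessProb i (bellState e (q i)) ≤ (m : ℝ)⁻¹ * ∑ j : ZMod m, ∑ l : ZMod m,
      Q.guessProb i (prodVec (EuclideanSpace.single (e j) 1) (EuclideanSpace.single (e l) 1)) := by
    intro i
    have := Q.guessProb_sum_prodVec_le i (C := (√m)⁻¹)
      (c := fun j => ZMod.stdAddChar (j * (q i).1) * ((√m : ℝ) : ℂ)⁻¹)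
      (fun j => by simp [abs_of_nonneg (Real.sqrt_nonneg _)])
      (Equiv.addRight (q i).2) (fun j => EuclideanSpace.single (e j) 1)
      (fun j => EuclideanSpace.single (e j) 1)
    rwa [inv_pow, Real.sq_sqrt (Nat.cast_nonneg m)] at this
  refine (Finset.sum_le_sum fun i _ => h i).trans ?_
  rw [← Finset.mul_sum, Finset.sum_comm, Finset.sum_congr rfl fun j _ => Finset.sum_comm]
  -- By termination the guess probabilities on each product basis vector sum to one.
  simp_rw [hQ _ (show ‖prodVec (EuclideanSpace.single _ 1) (EuclideanSpace.single _ 1)‖ = 1 by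
    simp [norm_prodVec])]
  simp [ZMod.card, hm0]

theorem loccWorstCase_le {k : ℕ} (hk : 0 < k) (hkm : k ≤ m ^ 2) (hmn : m ≤ n) : loccWorstCase k n ≤ m / k := by
  obtain ⟨e⟩ : Nonempty (ZMod m ↪ Fin n) :=
    Function.Embedding.nonempty_of_card_le (by simpa [ZMod.card] using hmn)
  obtain ⟨q⟩ : Nonempty (Fin k ↪ ZMod m × ZMod m) :=
    Function.Embedding.nonempty_of_card_le (by simpa [ZMod.card, ← sq] using hkm)
  have hk0 : (k : ℝ) ≠ 0 := Nat.cast_ne_zero.2 hk.ne'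
  have hle := (isLeast_loccWorstCase hk (hkm.trans (Nat.pow_le_pow_left hmn 2))).2
    ⟨fun i => bellState e (q i), fun _ => (k : ℝ)⁻¹,
      (orthonormal_bellState e).comp q q.injective, ⟨fun _ => by positivity, by simp [hk0]⟩, rfl⟩
  -- An empty real supremum is `0`, so nonnegativity of the bound replaces the existence of a
  -- protocol.
  refine hle.trans (Real.iSup_le (fun Q => ?_) (by positivity))
  rw [← Finset.mul_sum, div_eq_inv_mul]
  gcongr
  exact Q.1.sum_guessProb_bellState_le Q.2 e q

end BellStates

/-! ### Zero diagonal of a traceless matrix. -/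

section ZeroDiagonal

open Matrix

variable {n : ℕ}

/-- `∑ i, v_i v_i†`. -/
def outerSum {d : ℕ} (v : Fin d → Fin n → ℂ) : Matrix (Fin n) (Fin n) ℂ :=
  ∑ i, vecMulVec (v i) (star (v i))

theorem outerSum_cons {d : ℕ} (x : Fin n → ℂ) (v : Fin d → Fin n → ℂ) :
    outerSum (Fin.cons x v : Fin (d + 1) → Fin n → ℂ) = vecMulVec x (star x) + outerSum v := by
  simp [outerSum, Fin.sum_univ_succ]

theorem trace_mul_outerSum (M : Matrix (Fin n) (Fin n) ℂ) {d : ℕ} (v : Fin d → Fin n → ℂ) :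
    (M * outerSum v).trace = ∑ i, star (v i) ⬝ᵥ M *ᵥ v i := by
  simp only [outerSum, Finset.mul_sum, trace_sum, mul_vecMulVec, trace_vecMulVec]
  exact Finset.sum_congr rfl fun i _ => dotProduct_comm _ _

/-- The imaginary part equals that of `w * (β - star γ)`, and `w` can cancel the phase of `β - star
γ`. -/
theorem exists_norm_eq_one_mul_add_conj_mul_im_eq_zero (β γ : ℂ) :
    ∃ w : ℂ, ‖w‖ = 1 ∧ (w * β + star w * γ).im = 0 := by
  refine ⟨Complex.exp (-(β - star γ).arg * Complex.I), ?_, ?_⟩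
  · rw [← Complex.ofReal_neg, Complex.norm_exp_ofReal_mul_I]
  · set w := Complex.exp (-(β - star γ).arg * Complex.I) with hw
    have h : w * (β - star γ) = ‖β - star γ‖ := by
      conv_lhs => rw [← Complex.norm_mul_exp_arg_mul_I (β - star γ), hw, mul_left_comm,
        ← Complex.exp_add]
      simp
    have h' := congrArg Complex.im h
    simp only [Complex.ofReal_im] at h'
    rw [← h']
    simp [Complex.mul_im]
    ring

/-- Intermediate value theorem: the expression is `0` at `θ = 0` and `1` at `θ = π / 2`. -/
theorem exists_sin_cos_eq (r : ℝ) {t : ℝ} (h0 : 0 ≤ t) (h1 : t ≤ 1) :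
    ∃ θ : ℝ, Real.sin θ ^ 2 + Real.cos θ * Real.sin θ * r = t := by
  have hc : ContinuousOn (fun θ : ℝ => Real.sin θ ^ 2 + Real.cos θ * Real.sin θ * r)
      (Set.Icc 0 (Real.pi / 2)) := by fun_prop
  obtain ⟨θ, -, hθ⟩ := intermediate_value_Icc (by positivity) hc
    (show t ∈ Set.Icc _ _ by simpa using ⟨h0, h1⟩)
  exact ⟨θ, hθ⟩

/-- Two vectors can be replaced by two combinations with the same `x x† + y y†`, the first of
which takes a prescribed value of the quadratic form of `M` on the segment between the values
at `x` and `y`. -/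
theorem exists_pair_quadraticForm_eq (M : Matrix (Fin n) (Fin n) ℂ) (x y : Fin n → ℂ) {t : ℝ}
    (h0 : 0 ≤ t) (h1 : t ≤ 1) :
    ∃ x' y' : Fin n → ℂ,
      vecMulVec x' (star x') + vecMulVec y' (star y') =
        vecMulVec x (star x) + vecMulVec y (star y) ∧
      star x' ⬝ᵥ M *ᵥ x' = (1 - t) * (star x ⬝ᵥ M *ᵥ x) + t * (star y ⬝ᵥ M *ᵥ y) := by
  set D := star y ⬝ᵥ M *ᵥ y - star x ⬝ᵥ M *ᵥ x with hD
  by_cases hD0 : D = 0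
  · exact ⟨x, y, rfl, by linear_combination (-(t : ℂ)) * hD0 + (t : ℂ) * hD⟩
  -- Rephasing `y` by `w` makes the cross terms a real multiple `r * D`. The form at `cos θ • x +
  -- sin θ • (w • y)` then moves along the line through the two values, at parameter `sin² θ + cos θ
  -- sin θ r`.
  obtain ⟨w, hw, him⟩ := exists_norm_eq_one_mul_add_conj_mul_im_eq_zero
    ((star x ⬝ᵥ M *ᵥ y) / D) ((star y ⬝ᵥ M *ᵥ x) / D)
  set β := star x ⬝ᵥ M *ᵥ y
  set γ := star y ⬝ᵥ M *ᵥ x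
  obtain ⟨r, hr⟩ : ∃ r : ℝ, w * β + star w * γ = r * D := by
    refine ⟨(w * (β / D) + star w * (γ / D)).re, ?_⟩
    have : (((w * (β / D) + star w * (γ / D)).re : ℝ) : ℂ) = w * (β / D) + star w * (γ / D) :=
      Complex.ext (by simp) (by simpa using him.symm)
    rw [this]
    field_simp
  obtain ⟨θ, hθ⟩ := exists_sin_cos_eq r h0 h1
  have hww : w * star w = 1 := by simp [Complex.mul_conj', hw]
  have hsc : (Real.cos θ : ℂ) ^ 2 + (Real.sin θ : ℂ) ^ 2 = 1 := by
    exact_mod_cast Real.cos_sq_add_sin_sq θ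
  have hθ' : (Real.sin θ : ℂ) ^ 2 + Real.cos θ * Real.sin θ * r = t := by exact_mod_cast hθ
  generalize (Real.cos θ : ℝ) = c at hsc hθ'
  generalize (Real.sin θ : ℝ) = s at hsc hθ'
  -- A unitary recombination of `x` and `y`, which therefore preserves the sum of outer products.
  refine ⟨(c : ℂ) • x + ((s : ℂ) * w) • y, (-(s : ℂ)) • x + ((c : ℂ) * w) • y, ?_, ?_⟩
  · ext i j
    simp only [vecMulVec_apply, Matrix.add_apply, Pi.star_apply, Pi.add_apply, Pi.smul_apply, smul_eq_mul,
      star_add, star_mul', star_neg, Complex.star_def, Complex.conj_ofReal] at hww ⊢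
    linear_combination (x i * (starRingEnd ℂ) (x j) +
      y i * (starRingEnd ℂ) (y j) * (w * (starRingEnd ℂ) w)) * hsc +
      y i * (starRingEnd ℂ) (y j) * hww
  · simp only [star_add, star_smul, mulVec_add, mulVec_smul, add_dotProduct, dotProduct_add,
      smul_dotProduct, dotProduct_smul, smul_eq_mul, star_mul', Complex.star_def,
      Complex.conj_ofReal] at hww hr ⊢
    linear_combination (star x ⬝ᵥ M *ᵥ x) * hsc + (s : ℂ) ^ 2 * (star y ⬝ᵥ M *ᵥ y) * hww +
      (c : ℂ) * s * hr + D * hθ' + ((t : ℂ) - s ^ 2) * hD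

/-- The head is made to take the mean value. By induction the head of the tail takes the mean of the
tail, and the overall mean lies on the segment from the value at `v 0` to that one. -/
theorem exists_family_head_quadraticForm_eq (M : Matrix (Fin n) (Fin n) ℂ) (d : ℕ)
    (v : Fin (d + 1) → Fin n → ℂ) :
    ∃ v' : Fin (d + 1) → Fin n → ℂ, outerSum v' = outerSum v ∧
      (d + 1) * (star (v' 0) ⬝ᵥ M *ᵥ v' 0) = ∑ i, star (v i) ⬝ᵥ M *ᵥ v i := by
  induction d with
  | zero => exact ⟨v, rfl, by simp⟩
  | succ d ih =>
    obtain ⟨u, hu, hu0⟩ := ih (Fin.tail v)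
    -- The tail holds `d + 1` of the `d + 2` vectors; this is its weight in the mean.
    have ht : 0 ≤ ((d : ℝ) + 1) / (d + 2) ∧ ((d : ℝ) + 1) / (d + 2) ≤ 1 :=
      ⟨by positivity, by rw [div_le_one (by positivity)]; linarith⟩
    obtain ⟨x, y, hxy, hx⟩ := exists_pair_quadraticForm_eq M (v 0) (u 0) ht.1 ht.2
    refine ⟨Fin.cons x (Fin.cons y (Fin.tail u)), ?_, ?_⟩
    · rw [outerSum_cons, outerSum_cons, ← add_assoc, hxy, add_assoc, ← outerSum_cons,
        Fin.cons_self_tail, hu, ← outerSum_cons, Fin.cons_self_tail]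
    · rw [Fin.sum_univ_succ, Fin.cons_zero, hx]
      change _ = _ + ∑ i, star (Fin.tail v i) ⬝ᵥ M *ᵥ Fin.tail v i
      rw [← hu0]
      have : (d : ℂ) + 2 ≠ 0 := by exact_mod_cast (by positivity : (d : ℝ) + 2 ≠ 0)
      push_cast
      field_simp
      ring

/-- The sum of the values is `trace (M * outerSum v)`, so it depends only on `outerSum v`. Once the
head takes the mean value zero, the tail still sums to zero and the argument recurses. -/
theorem exists_family_quadraticForm_eq_zero (M : Matrix (Fin n) (Fin n) ℂ) (d : ℕ)
    (v : Fin d → Fin n → ℂ) (hv : ∑ i, star (v i) ⬝ᵥ M *ᵥ v i = 0) :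
    ∃ v' : Fin d → Fin n → ℂ, outerSum v' = outerSum v ∧ ∀ i, star (v' i) ⬝ᵥ M *ᵥ v' i = 0 := by
  induction d with
  | zero => exact ⟨v, rfl, fun i => i.elim0⟩
  | succ d ih =>
    obtain ⟨u, hu, hu0⟩ := exists_family_head_quadraticForm_eq M d v
    have h0 : star (u 0) ⬝ᵥ M *ᵥ u 0 = 0 := by
      rw [hv] at hu0
      exact (mul_eq_zero.1 hu0).resolve_left (Nat.cast_add_one_ne_zero d)
    have htail : ∑ i, star (Fin.tail u i) ⬝ᵥ M *ᵥ Fin.tail u i = 0 := by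
      have h := trace_mul_outerSum M u
      rw [hu, trace_mul_outerSum, hv, Fin.sum_univ_succ, h0, zero_add] at h
      exact h.symm
    obtain ⟨u', hu', hz⟩ := ih (Fin.tail u) htail
    refine ⟨Fin.cons (u 0) u', ?_, Fin.cases h0 hz⟩
    rw [outerSum_cons, hu', ← outerSum_cons, Fin.cons_self_tail, hu]

/-- A traceless matrix vanishes on the diagonal of some rank one measurement. -/
theorem exists_outerSum_eq_one_of_trace_eq_zero {M : Matrix (Fin n) (Fin n) ℂ}
    (hM : M.trace = 0) :
    ∃ v : Fin n → Fin n → ℂ, outerSum v = 1 ∧ ∀ i, star (v i) ⬝ᵥ M *ᵥ v i = 0 := by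
  have h1 : outerSum (fun i : Fin n => (Pi.single i 1 : Fin n → ℂ)) = 1 := by
    ext i j
    simp [outerSum, Matrix.sum_apply, vecMulVec_apply, Pi.single_apply, Matrix.one_apply]
  obtain ⟨v, hv, hz⟩ := exists_family_quadraticForm_eq_zero M n (fun i => Pi.single i 1)
    (by rw [← trace_mul_outerSum, h1, mul_one, hM])
  exact ⟨v, hv.trans h1, hz⟩

end ZeroDiagonal

/-- Finite protocol trees on `ℂ^a ⊗ ℂ^b` with guesses in `Fin k` at the leaves. -/
inductive LOCCTree (k : ℕ) : ℕ → ℕ → Type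
  | halt {a b : ℕ} (guess : Fin k) : LOCCTree k a b
  | alice {a b : ℕ} (M : LocalMeasurement a) (next : ∀ j, LOCCTree k (M.outDim j) b) :
    LOCCTree k a b
  | bob {a b : ℕ} (M : LocalMeasurement b) (next : ∀ j, LOCCTree k a (M.outDim j)) :
    LOCCTree k a b

/-! ### Finite trees as terminating protocols, each subtree being its own classical state. -/

namespace LOCCTree

variable {k : ℕ}

/-- The first step of a protocol tree. -/
def move : {a b : ℕ} → LOCCTree k a b → LOCCMove k (LOCCTree k) a b
  | _, _, halt g => .halt g
  | _, _, alice M next => .alice M next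
  | _, _, bob M next => .bob M next

/-- The protocol that follows a tree. -/
abbrev toProtocol {a b : ℕ} (T : LOCCTree k a b) : LOCCProtocol k a b where
  State := LOCCTree k
  move := move
  start := T

/-- The weight with which the tree ends with the guess `i`. -/
noncomputable def weight (i : Fin k) :
    {a b : ℕ} → LOCCTree k a b → EuclideanSpace ℂ (Fin a × Fin b) → ℝ
  | _, _, halt g, ψ => if g = i then ‖ψ‖ ^ 2 else 0
  | _, _, alice M next, ψ => ∑ j, weight i (next j) (applyAlice (M.K j) ψ)
  | _, _, bob M next, ψ => ∑ j, weight i (next j) (applyBob (M.K j) ψ)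

theorem weight_nonneg (i : Fin k) {a b : ℕ} (T : LOCCTree k a b)
    (ψ : EuclideanSpace ℂ (Fin a × Fin b)) : 0 ≤ T.weight i ψ := by
  induction T with
  | halt g => rw [weight]; positivity
  | alice M next ih => rw [weight]; exact Finset.sum_nonneg fun j _ => ih j _
  | bob M next ih => rw [weight]; exact Finset.sum_nonneg fun j _ => ih j _

theorem sum_weight {a b : ℕ} (T : LOCCTree k a b) (ψ : EuclideanSpace ℂ (Fin a × Fin b)) :
    ∑ i, T.weight i ψ = ‖ψ‖ ^ 2 := by
  induction T with
  | halt g => simp [weight]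
  | alice M next ih =>
    simp_rw [weight]
    rw [Finset.sum_comm, Finset.sum_congr rfl fun j _ => ih j _, M.sum_norm_sq_applyAlice]
  | bob M next ih =>
    simp_rw [weight]
    rw [Finset.sum_comm, Finset.sum_congr rfl fun j _ => ih j _, M.sum_norm_sq_applyBob]

section ToProtocol

variable {c d : ℕ} (T₀ : LOCCTree k c d) (i : Fin k) {a b : ℕ}

theorem guessProbWithin_halt (r : ℕ) (g : Fin k) (ψ : EuclideanSpace ℂ (Fin a × Fin b)) :
    T₀.toProtocol.guessProbWithin i r (halt g : LOCCTree k a b) ψ =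
      (halt g : LOCCTree k a b).weight i ψ :=
  T₀.toProtocol.guessProbWithin_of_halt i (s := (halt g : LOCCTree k a b)) rfl r ψ

theorem guessProbWithin_succ_alice (r : ℕ) (M : LocalMeasurement a)
    (next : ∀ j, LOCCTree k (M.outDim j) b) (ψ : EuclideanSpace ℂ (Fin a × Fin b)) :
    T₀.toProtocol.guessProbWithin i (r + 1) (alice M next : LOCCTree k a b) ψ =
      ∑ j, T₀.toProtocol.guessProbWithin i r (next j) (applyAlice (M.K j) ψ) :=
  T₀.toProtocol.guessProbWithin_succ_of_alice i (s := (alice M next : LOCCTree k a b)) rfl r ψ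

theorem guessProbWithin_succ_bob (r : ℕ) (M : LocalMeasurement b)
    (next : ∀ j, LOCCTree k a (M.outDim j)) (ψ : EuclideanSpace ℂ (Fin a × Fin b)) :
    T₀.toProtocol.guessProbWithin i (r + 1) (bob M next : LOCCTree k a b) ψ =
      ∑ j, T₀.toProtocol.guessProbWithin i r (next j) (applyBob (M.K j) ψ) :=
  T₀.toProtocol.guessProbWithin_succ_of_bob i (s := (bob M next : LOCCTree k a b)) rfl r ψ

theorem guessProbWithin_le_weight (r : ℕ) (T : LOCCTree k a b)
    (ψ : EuclideanSpace ℂ (Fin a × Fin b)) :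
    T₀.toProtocol.guessProbWithin i r T ψ ≤ T.weight i ψ := by
  induction T generalizing r with
  | halt g => exact (T₀.guessProbWithin_halt i r g ψ).le
  | alice M next ih =>
    cases r with
    | zero =>
      exact (T₀.toProtocol.guessProbWithin_zero_of_alice i (s := alice M next) rfl ψ).trans_le
        (weight_nonneg i _ ψ)
    | succ r =>
      rw [guessProbWithin_succ_alice, weight]
      exact Finset.sum_le_sum fun j _ => ih j _ _
  | bob M next ih =>
    cases r with
    | zero =>
      exact (T₀.toProtocol.guessProbWithin_zero_of_bob i (s := bob M next) rfl ψ).trans_le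
        (weight_nonneg i _ ψ)
    | succ r =>
      rw [guessProbWithin_succ_bob, weight]
      exact Finset.sum_le_sum fun j _ => ih j _ _

/-- `R` bounds the depth of the tree, which is finite since each measurement has finitely many
outcomes. -/
theorem exists_guessProbWithin_eq_weight (T : LOCCTree k a b) :
    ∃ R : ℕ, ∀ r, R ≤ r → ∀ ψ : EuclideanSpace ℂ (Fin a × Fin b),
      T₀.toProtocol.guessProbWithin i r T ψ = T.weight i ψ := by
  induction T with
  | halt g => exact ⟨0, fun r _ ψ => T₀.guessProbWithin_halt i r g ψ⟩
  | alice M next ih =>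
    choose R hR using ih
    refine ⟨Finset.univ.sup R + 1, fun r hr ψ => ?_⟩
    obtain ⟨r, rfl⟩ := Nat.exists_eq_add_of_le' hr
    rw [← add_assoc, guessProbWithin_succ_alice, weight]
    exact Finset.sum_congr rfl fun j _ =>
      hR j _ ((Finset.le_sup (Finset.mem_univ j)).trans (Nat.le_add_left _ _)) _
  | bob M next ih =>
    choose R hR using ih
    refine ⟨Finset.univ.sup R + 1, fun r hr ψ => ?_⟩
    obtain ⟨r, rfl⟩ := Nat.exists_eq_add_of_le' hr
    rw [← add_assoc, guessProbWithin_succ_bob, weight]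
    exact Finset.sum_congr rfl fun j _ =>
      hR j _ ((Finset.le_sup (Finset.mem_univ j)).trans (Nat.le_add_left _ _)) _

end ToProtocol

theorem guessProb_toProtocol {a b : ℕ} (T : LOCCTree k a b) (i : Fin k)
    (ψ : EuclideanSpace ℂ (Fin a × Fin b)) : T.toProtocol.guessProb i ψ = T.weight i ψ := by
  obtain ⟨R, hR⟩ := T.exists_guessProbWithin_eq_weight i T
  refine le_antisymm (ciSup_le fun r => T.guessProbWithin_le_weight i r T ψ) ?_
  rw [← hR R le_rfl ψ]
  exact le_ciSup (T.toProtocol.bddAbove_guessProbWithin i ψ) R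

theorem terminates_toProtocol {a b : ℕ} (T : LOCCTree k a b) : T.toProtocol.Terminates := by
  intro ψ hψ
  simp_rw [guessProb_toProtocol]
  rw [sum_weight, hψ, one_pow]

end LOCCTree

/-! ### Distinguishing two orthogonal states, and the lower bound. -/

section TwoStates

open Matrix

/-- The rank one measurement with Kraus operators `v_j†`. -/
def rankOneMeasurement {n : ℕ} (v : Fin n → Fin n → ℂ) (hv : outerSum v = 1) :
    LocalMeasurement n where
  numOutcomes := n
  outDim _ := 1
  K j := Matrix.of fun _ => star (v j)
  complete := by
    rw [← hv, outerSum]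
    refine Finset.sum_congr rfl fun j _ => ?_
    ext x y
    simp [Matrix.mul_apply, vecMulVec_apply]

/-- The two-outcome measurement of a Hermitian projection and its complement. -/
def projMeasurement {n : ℕ} (P : Matrix (Fin n) (Fin n) ℂ) (hP : P.IsHermitian)
    (hPP : P * P = P) : LocalMeasurement n where
  numOutcomes := 2
  outDim _ := n
  K j := if j = 0 then P else 1 - P
  complete := by
    simp [Fin.sum_univ_two, hP.eq, conjTranspose_sub, sub_mul, mul_sub, hPP]

open scoped ComplexOrder in
theorem exists_proj_of_dotProduct_eq_zero {n : ℕ} {u w : Fin n → ℂ} (h : star u ⬝ᵥ w = 0) :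
    ∃ P : Matrix (Fin n) (Fin n) ℂ, P.IsHermitian ∧ P * P = P ∧ P *ᵥ u = u ∧ P *ᵥ w = 0 := by
  by_cases hu : u = 0
  -- A conditional state vanishes when its outcome has probability zero.
  · exact ⟨0, isHermitian_zero, by simp, by simp [hu], by simp⟩
  have h0 : star u ⬝ᵥ u ≠ 0 := mt dotProduct_star_self_eq_zero.1 hu
  have hstar : star (star u ⬝ᵥ u) = star u ⬝ᵥ u := by
    rw [← ofReal_sum_norm_sq_eq_dotProduct]; exact Complex.conj_ofReal _
  refine ⟨(star u ⬝ᵥ u)⁻¹ • vecMulVec u (star u), ?_, ?_, ?_, ?_⟩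
  · rw [IsHermitian, conjTranspose_smul, conjTranspose_vecMulVec, star_star, star_inv₀, hstar]
  · rw [smul_mul_smul_comm, vecMulVec_mul_vecMulVec, vecMulVec_smul, smul_smul, mul_assoc,
      inv_mul_cancel₀ h0, mul_one]
  · rw [smul_mulVec, vecMulVec_mulVec]
    simp [smul_smul, h0]
  · rw [smul_mulVec, vecMulVec_mulVec, h]
    simp

/-- Two orthogonal states can be identified with certainty. -/
theorem exists_tree_of_inner_eq_zero {k n : ℕ} {i₀ i₁ : Fin k}
    {ψ₀ ψ₁ : EuclideanSpace ℂ (Fin n × Fin n)} (h : inner ℂ ψ₀ ψ₁ = 0) :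
    ∃ T : LOCCTree k n n, ‖ψ₀‖ ^ 2 ≤ T.weight i₀ ψ₀ ∧ ‖ψ₁‖ ^ 2 ≤ T.weight i₁ ψ₁ := by
  -- With coefficient matrices this is `ψ₁ ψ₀†`. Its trace is the inner product of the states, and
  -- `v_j† (ψ₁ ψ₀†) v_j` is the inner product of Bob's conditional states after outcome `j`.
  obtain ⟨v, hv, hz⟩ := exists_outerSum_eq_one_of_trace_eq_zero
    (M := Matrix.of fun x y => ∑ z, ψ₁ (x, z) * star (ψ₀ (y, z))) (by
      rw [← h]
      simp [Matrix.trace, PiLp.inner_apply, Fintype.sum_prod_type])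
  set K : Fin n → Matrix (Fin 1) (Fin n) ℂ := fun j => Matrix.of fun _ => star (v j) with hK
  have hsum : ∀ ψ : EuclideanSpace ℂ (Fin n × Fin n), ∑ j, ‖applyAlice (K j) ψ‖ ^ 2 = ‖ψ‖ ^ 2 :=
    (rankOneMeasurement v hv).sum_norm_sq_applyAlice
  have horth : ∀ j, star (fun y => applyAlice (K j) ψ₀ (0, y)) ⬝ᵥ
      (fun y => applyAlice (K j) ψ₁ (0, y)) = 0 := by
    intro j
    rw [← hz j]
    simp only [applyAlice_apply, dotProduct, mulVec, Pi.star_apply, star_sum, star_mul',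
      Finset.sum_mul, Finset.mul_sum, of_apply, hK, star_star]
    rw [Finset.sum_congr rfl fun _ _ => Finset.sum_comm, Finset.sum_comm,
      Finset.sum_congr rfl fun _ _ => Finset.sum_comm, Finset.sum_comm]
    refine Finset.sum_congr rfl fun x _ => Finset.sum_congr rfl fun y _ =>
      Finset.sum_congr rfl fun z _ => by ring
  choose P hP hPP hP0 hP1 using fun j => exists_proj_of_dotProduct_eq_zero (horth j)
  -- After a rank one outcome Alice's space is one-dimensional, so the state is a vector of Bob's
  -- space.
  have hrow : ∀ (B : Matrix (Fin n) (Fin n) ℂ) (φ : EuclideanSpace ℂ (Fin 1 × Fin n)),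
      B *ᵥ (fun y => φ (0, y)) = (fun y => φ (0, y)) → applyBob B φ = φ := by
    intro B φ hB
    ext ⟨x, y⟩
    obtain rfl : x = 0 := Subsingleton.elim _ _
    rw [applyBob_apply]
    exact congrFun hB y
  -- Bob's projection `P j` fixes his conditional state of `ψ₀` and annihilates that of `ψ₁`.
  let T : LOCCTree k n n := .alice (rankOneMeasurement v hv) fun j =>
    .bob (projMeasurement (P j) (hP j) (hPP j)) fun l : Fin 2 => .halt (if l = 0 then i₀ else i₁)
  have hT : ∀ i ψ, T.weight i ψ =
      ∑ j, ((if i₀ = i then ‖applyBob (P j) (applyAlice (K j) ψ)‖ ^ 2 else 0) +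
        if i₁ = i then ‖applyBob (1 - P j) (applyAlice (K j) ψ)‖ ^ 2 else 0) := fun i ψ =>
    Finset.sum_congr rfl fun j _ => Fin.sum_univ_two _
  refine ⟨T, ?_, ?_⟩
  · rw [← hsum, hT]
    refine Finset.sum_le_sum fun j _ => ?_
    rw [hrow _ _ (hP0 j), if_pos rfl]
    exact le_add_of_nonneg_right (by positivity)
  · rw [← hsum, hT]
    refine Finset.sum_le_sum fun j _ => ?_
    rw [hrow (1 - P j) _ (by rw [sub_mulVec, hP1 j]; simp), if_pos rfl]
    exact le_add_of_nonneg_left (by positivity)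

/-- Average `p i + p (i + 1)` over the cyclic shift: the total is `2`. Writing `k` as `l + 2` makes
`i + 1 ≠ i` available. -/
theorem exists_pair_two_div_le {k : ℕ} (hk : 2 ≤ k) {p : Fin k → ℝ}
    (hp : p ∈ stdSimplex ℝ (Fin k)) : ∃ i j, i ≠ j ∧ 2 / (k : ℝ) ≤ p i + p j := by
  obtain ⟨k, rfl⟩ : ∃ l, k = l + 2 := Nat.exists_eq_add_of_le' hk
  have hsum : ∑ _i : Fin (k + 2), 2 / ((k + 2 : ℕ) : ℝ) ≤
      ∑ i : Fin (k + 2), (p i + p (Equiv.addRight 1 i)) := by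
    rw [Finset.sum_add_distrib, Equiv.sum_comp (Equiv.addRight (1 : Fin (k + 2))) p, hp.2]
    simp only [Finset.sum_const, Finset.card_univ, Fintype.card_fin, nsmul_eq_mul]
    rw [mul_div_cancel₀ _ (by positivity)]
    norm_num
  obtain ⟨i, -, hi⟩ := Finset.exists_le_of_sum_le Finset.univ_nonempty hsum
  exact ⟨i, _, by simp, hi⟩

/-- The perfect protocol for the best pair is used; the remaining states contribute nonnegatively.
-/
theorem two_div_le_loccSuccess {k n : ℕ} (hk : 2 ≤ k)
    {Ψ : Fin k → EuclideanSpace ℂ (Fin n × Fin n)} {p : Fin k → ℝ} (hΨ : Orthonormal ℂ Ψ)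
    (hp : p ∈ stdSimplex ℝ (Fin k)) : 2 / (k : ℝ) ≤ loccSuccess Ψ p := by
  obtain ⟨i, j, hij, hle⟩ := exists_pair_two_div_le hk hp
  obtain ⟨T, hi, hj⟩ := exists_tree_of_inner_eq_zero (i₀ := i) (i₁ := j) (hΨ.2 hij)
  refine hle.trans (le_trans ?_ (le_ciSup (bddAbove_range_sum_mul_guessProb hΨ.1 hp)
    ⟨T.toProtocol, T.terminates_toProtocol⟩))
  simp_rw [T.guessProb_toProtocol]
  rw [hΨ.1, one_pow] at hi hj
  calc p i + p j ≤ p i * T.weight i (Ψ i) + p j * T.weight j (Ψ j) :=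
        add_le_add (le_mul_of_one_le_right (hp.1 i) hi) (le_mul_of_one_le_right (hp.1 j) hj)
    _ = ∑ l ∈ {i, j}, p l * T.weight l (Ψ l) := (Finset.sum_pair (f := fun l => p l * T.weight l (Ψ l)) hij).symm
    _ ≤ _ := Finset.sum_le_univ_sum_of_nonneg fun l =>
        mul_nonneg (hp.1 l) (T.weight_nonneg l (Ψ l))

theorem two_div_le_loccWorstCase {k n : ℕ} (hk : 2 ≤ k) (hkn : k ≤ n ^ 2) :
    2 / (k : ℝ) ≤ loccWorstCase k n := by
  obtain ⟨Ψ, p, hΨ, hp, h⟩ := (isLeast_loccWorstCase (by omega) hkn).1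
  exact h ▸ two_div_le_loccSuccess hk hΨ hp

end TwoStates

theorem mainTheorem5 :
    (∀ k n : ℕ, 2 ≤ n → 2 ≤ k → k ≤ n ^ 2 →
      IsLeast (loccSuccessValues k n) (loccWorstCase k n)) ∧
    (∀ k n : ℕ, 2 ≤ n → n ≤ k → k ≤ n ^ 2 →
      2 / (k : ℝ) ≤ loccWorstCase k n ∧
      loccWorstCase k n ≤ (⌈Real.sqrt (k : ℝ)⌉₊ : ℝ) / (k : ℝ)) ∧
    (∀ n : ℕ, 2 ≤ n → loccWorstCase 3 n = 2 / 3 ∧ loccWorstCase 4 n = 1 / 2) := by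
  refine ⟨fun k n _ hk hkn => isLeast_loccWorstCase (by omega) hkn,
    fun k n hn hnk hkn => ⟨two_div_le_loccWorstCase (hn.trans hnk) hkn, ?_⟩, fun n hn => ?_⟩
  · have hk : 0 < k := by omega
    have : NeZero ⌈√(k : ℝ)⌉₊ := ⟨(Nat.ceil_pos.2 (by positivity)).ne'⟩
    -- `m = ⌈√k⌉` is the least integer with `k ≤ m ^ 2`, and `k ≤ n ^ 2` forces `m ≤ n`.
    refine loccWorstCase_le hk ?_ ?_
    · have h := Nat.le_ceil √(k : ℝ)
      rw [Real.sqrt_le_left (by positivity)] at h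
      exact_mod_cast h
    · rw [Nat.ceil_le, Real.sqrt_le_left (by positivity)]
      exact_mod_cast hkn
  · have h4 : 4 ≤ n ^ 2 := Nat.pow_le_pow_left hn 2
    have h3 : 3 ≤ n ^ 2 := by omega
    constructor
    · refine le_antisymm ?_ ?_
      · simpa using loccWorstCase_le (m := 2) (k := 3) (by norm_num) (by norm_num) hn
      · simpa using two_div_le_loccWorstCase (k := 3) (by norm_num) h3
    · refine le_antisymm ?_ ?_
      · have := loccWorstCase_le (m := 2) (k := 4) (by norm_num) (by norm_num) hn
        norm_num at this ⊢
        exact this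
      · have := two_div_le_loccWorstCase (k := 4) (by norm_num) h4
        norm_num at this ⊢
        exact this
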